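/- An energy harvesting transmitter has energy $E_0\ge 0$ at time $s_0=0$ and receives energy $E_i\ge 0$ at the instants $s_i$, $i=1,\dots,N$, where $0<s_1<\dots<s_N<D$ and $D$ is the deadline. Let $a,b\ge 0$ and $T_e<T_c$. For a power policy $P$ the temperature is the solution of $T'(t)=aP(t)-b(T(t)-T_e)$, $T(0)=T_e$, that is, $$T(t)=e^{-bt}\Big(\int_0^t e^{b\tau}\big(aP(\tau)+bT_e\big)\,d\tau+T_e\Big).$$ Let $P$ be an optimal policy, i.e. a maximizer of $\int_0^D\frac12\log_2(1+P(\tau))\,d\tau$ among the measurable functions $P\ge 0$ on $[0,D]$ with $$\int_0^tP(\tau)\,d\tau\le\sum_{i:\,s_i<t}E_i\quad\text{and}\quad T(t)\le T_c\qquad\text{for all }t\in[0,D].$$ If $P$ has a jump at $t\in(0,D)$ (that is, no function equal to $P$ almost everywhere is continuous at $t$), then $t=s_k$ is an energy arrival instant for some $k\in\{1,\dots,N\}$, the battery is empty at $t$ just before this arrival, i.e. $\int_0^tP(\tau)\,d\tau=\sum_{i:\,s_i<t}E_i$, and $T(t)<T_c$. -/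

import Mathlib

open MeasureTheory Filter Topology

noncomputable section

/-- An energy harvesting transmitter with a first order thermal model.
`D` is the deadline; energy `E i ≥ 0` becomes available at time `s i`, where
`0 = s 0 < s 1 < ⋯ < s N < D`; `a, b ≥ 0` are the constants of the thermal dynamics
`T' = a P - b (T - Te)`; `Te` is the temperature of the environment (and the initial temperature)
and `Tc > Te` is the critical temperature. -/
structure Transmitter where
  D : ℝ
  N : ℕ
  s : Fin (N + 1) → ℝ
  E : Fin (N + 1) → ℝ
  a : ℝ
  b : ℝ
  Te : ℝ
  Tc : ℝ
  s_zero : s 0 = 0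
  s_strictMono : StrictMono s
  s_lt_D : ∀ i, s i < D
  E_nonneg : ∀ i, 0 ≤ E i
  a_nonneg : 0 ≤ a
  b_nonneg : 0 ≤ b
  Te_lt_Tc : Te < Tc

namespace Transmitter

/-- The energy harvested strictly before time `t`, i.e. `∑_{i ≤ h(t)} E i` with
`h(t) = max {k : s k < t}` (the sum is empty for `t = 0`). -/
def harvested (m : Transmitter) (t : ℝ) : ℝ :=
  ∑ i with m.s i < t, m.E i

/-- The energy spent by the policy `P` up to time `t`. -/
def spent (P : ℝ → ℝ) (t : ℝ) : ℝ :=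
  ∫ τ in (0 : ℝ)..t, P τ

/-- The temperature at time `t` under the policy `P`: the solution of
`T' = a P - b (T - Te)` with `T 0 = Te`. -/
def temperature (m : Transmitter) (P : ℝ → ℝ) (t : ℝ) : ℝ :=
  Real.exp (-(m.b * t)) *
    ((∫ τ in (0 : ℝ)..t, Real.exp (m.b * τ) * (m.a * P τ + m.b * m.Te)) + m.Te)

/-- The throughput of the policy `P` over `[0, D]`, in bits. -/
def throughput (m : Transmitter) (P : ℝ → ℝ) : ℝ :=
  ∫ τ in (0 : ℝ)..m.D, 1 / 2 * Real.logb 2 (1 + P τ)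

/-- Feasible policies: nonnegative measurable power functions on `[0, D]` of finite energy which
satisfy the temperature constraint and the energy causality constraint. Only the values of `P` on
`[0, D]` matter; `IntervalIntegrable` contains the measurability of `P` on that interval. -/
structure Feasible (m : Transmitter) (P : ℝ → ℝ) : Prop where
  integrable : IntervalIntegrable P volume 0 m.D
  nonneg : ∀ t ∈ Set.Icc 0 m.D, 0 ≤ P t
  temperature_le : ∀ t ∈ Set.Icc 0 m.D, m.temperature P t ≤ m.Tc
  causal : ∀ t ∈ Set.Icc 0 m.D, spent P t ≤ m.harvested t

/-- Optimal policies: feasible policies of maximal throughput. -/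
def IsOptimal (m : Transmitter) (P : ℝ → ℝ) : Prop :=
  m.Feasible P ∧ ∀ Q : ℝ → ℝ, m.Feasible Q → m.throughput Q ≤ m.throughput P

/-- Just before a possible arrival at time `t`, the battery is empty: all the energy harvested
before `t` has been spent by time `t`. -/
def BatteryEmpty (m : Transmitter) (P : ℝ → ℝ) (t : ℝ) : Prop :=
  spent P t = m.harvested t

end Transmitter

/-- `P` jumps at `t`: it has no (finite) limit at `t`, not even after a modification on a null set.
A policy is determined only up to a null set, so this is discontinuity at `t` of every
representative of `P`; it holds in particular if the one-sided limits at `t` differ. -/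
def HasJumpAt (P : ℝ → ℝ) (t : ℝ) : Prop :=
  ¬ ∃ l : ℝ, Tendsto P (ae volume ⊓ 𝓝 t) (𝓝 l)

/-- Distinct one-sided limits (up to a null set) make a jump. -/
theorem hasJumpAt_of_left_right {P : ℝ → ℝ} {t l r : ℝ}
    (hl : Tendsto P (ae volume ⊓ 𝓝[<] t) (𝓝 l)) (hr : Tendsto P (ae volume ⊓ 𝓝[>] t) (𝓝 r))
    (hlr : l ≠ r) : HasJumpAt P t := by
  have key : ∀ s : Set ℝ, (∀ u ∈ 𝓝[s] t, volume u ≠ 0) → (ae volume ⊓ 𝓝[s] t).NeBot := by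
    intro s hs
    rw [inf_neBot_iff]
    intro u hu v hv
    by_contra h
    apply hs v hv
    refine measure_mono_null (fun x hx hxu => h ⟨x, hxu, hx⟩) (mem_ae_iff.1 hu)
  rintro ⟨x, hx⟩
  have h1 : (ae volume ⊓ 𝓝[<] t).NeBot := by
    apply key
    intro u hu h0
    obtain ⟨y, hy, hyu⟩ := mem_nhdsLT_iff_exists_Ioo_subset.1 hu
    have := measure_mono_null hyu h0
    rw [Real.volume_Ioo, ENNReal.ofReal_eq_zero] at this
    simp only [Set.mem_Iio] at hy
    linarith
  have h2 : (ae volume ⊓ 𝓝[>] t).NeBot := by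
    apply key
    intro u hu h0
    obtain ⟨y, hy, hyu⟩ := mem_nhdsGT_iff_exists_Ioo_subset.1 hu
    have := measure_mono_null hyu h0
    rw [Real.volume_Ioo, ENNReal.ofReal_eq_zero] at this
    simp only [Set.mem_Ioi] at hy
    linarith
  have e1 := tendsto_nhds_unique hl (hx.mono_left (inf_le_inf_left _ nhdsWithin_le_nhds))
  have e2 := tendsto_nhds_unique hr (hx.mono_left (inf_le_inf_left _ nhdsWithin_le_nhds))
  exact hlr (e1.trans e2.symm)

end

/-! The proof perturbs an optimal policy by moving energy between two sets of times. By concavity of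
the logarithm such a move gains throughput when it goes from higher to lower (weighted) power
(`throughput_lt_transfer`), so it must break a constraint.

Moving energy later with density proportional to `e^{-bτ}` never breaks one: the heat `∫ e^{bτ} P`
sees the constant density 1, and the energy spent by any time does not grow. Hence `(1 + P) e^{bτ}`
is essentially nondecreasing (`IsOptimal.ess_monotone`), and `P` can only jump upwards, from at most
`p` to at least `q > p`.

At critical temperature, `a * heat` touches its bound `(Tc - Te) e^{bt}` from below. Comparing
slopes on both sides gives `a q ≤ (Tc - Te) b ≤ a p`, which is absurd
(`Feasible.temperature_lt_of_jump`). So the temperature constraint is slack at the jump. If the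
battery were not empty either, a little energy could be moved from just after `t` to just before
(`IsOptimal.batteryEmpty_of_jump`). Finally, an empty battery without an arrival cannot supply power
`q > 0` right after `t` (`Feasible.exists_eq_arrival`). -/

/-! ### Essential limits of essentially monotone functions -/

theorem exists_mem_Ioo_of_ae {c d : ℝ} (hcd : c < d) {p : ℝ → Prop}
    (hp : ∀ᵐ τ, τ ∈ Set.Ioo c d → p τ) : ∃ τ ∈ Set.Ioo c d, p τ := by
  by_contra! hne
  have hnull : volume {τ | ¬ (τ ∈ Set.Ioo c d → p τ)} = 0 := ae_iff.1 hp
  have : volume (Set.Ioo c d) = 0 :=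
    measure_mono_null (fun τ hτ => show ¬ _ from fun h => hne τ hτ (h hτ)) hnull
  rw [Real.volume_Ioo, ENNReal.ofReal_eq_zero] at this
  linarith

/-- An essentially nondecreasing function has an essential limit at `t`, unless it jumps up. -/
theorem exists_tendsto_or_jump_of_ess_monotone {u : ℝ → ℝ} {D t : ℝ} (ht : t ∈ Set.Ioo 0 D)
    (h0 : ∀ τ ∈ Set.Ioo 0 D, 0 ≤ u τ)
    (hu : ∀ c ∈ Set.Ioo 0 D, ∀ x y : ℝ, x < y →
      (∀ᵐ τ, τ ∈ Set.Ioo 0 c → u τ ≤ y) ∨ (∀ᵐ τ, τ ∈ Set.Ioo c D → x ≤ u τ)) :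
    (∃ l, Tendsto u (ae volume ⊓ 𝓝 t) (𝓝 l)) ∨
      ∃ x y : ℝ, x < y ∧ (∀ᵐ τ, τ ∈ Set.Ioo 0 t → u τ ≤ x) ∧
        (∀ᵐ τ, τ ∈ Set.Ioo t D → y ≤ u τ) := by
  obtain ⟨ht0, htD⟩ := ht
  -- The infimum of these essential upper bounds plays the role of the left limit.
  set S : Set ℝ := {y | ∀ᵐ τ, τ ∈ Set.Ioo 0 t → u τ ≤ y}
  have hS0 : ∀ y ∈ S, 0 ≤ y := fun y hy => by
    obtain ⟨τ, hτ, h⟩ := exists_mem_Ioo_of_ae ht0 hy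
    exact (h0 τ ⟨hτ.1, hτ.2.trans htD⟩).trans h
  have hbdd : BddBelow S := ⟨0, hS0⟩
  have hup : ∀ {y z : ℝ}, y ∈ S → y ≤ z → z ∈ S := fun {y z} hy hyz => by
    have hy' : ∀ᵐ τ, τ ∈ Set.Ioo 0 t → u τ ≤ y := hy
    have hz : ∀ᵐ τ, τ ∈ Set.Ioo 0 t → u τ ≤ z := by
      filter_upwards [hy'] with τ h hτ using (h hτ).trans hyz
    exact hz
  have hne : S.Nonempty := by
    by_contra hempty
    rw [Set.not_nonempty_iff_eq_empty] at hempty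
    have hall : ∀ n : ℕ, ∀ᵐ τ, τ ∈ Set.Ioo t D → (n : ℝ) ≤ u τ := fun n => by
      rcases hu t ⟨ht0, htD⟩ n (n + 1) (by linarith) with h | h
      · exact absurd (show (n + 1 : ℝ) ∈ S from h) (by simp [hempty])
      · exact h
    have h' : ∀ᵐ τ, τ ∈ Set.Ioo t D → ∀ n : ℕ, (n : ℝ) ≤ u τ := by
      filter_upwards [ae_all_iff.2 hall] with τ h hτ n using h n hτ
    obtain ⟨τ, _, h⟩ := exists_mem_Ioo_of_ae htD h'
    obtain ⟨n, hn⟩ := exists_nat_gt (u τ)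
    linarith [h n]
  rw [or_iff_not_imp_right]
  intro hjump
  refine ⟨sInf S, Metric.tendsto_nhds.2 fun ε hε => ?_⟩
  have hmem : sInf S + ε / 4 ∈ S := by
    obtain ⟨y, hy, hlt⟩ := exists_lt_of_csInf_lt hne (show sInf S < sInf S + ε / 4 by linarith)
    exact hup hy hlt.le
  have hnmem : sInf S - ε / 4 ∉ S := fun h => by linarith [csInf_le hbdd h]
  -- Otherwise the first alternative of `hu` holds at points tending to `t` from the left, which
  -- makes `sInf S - ε / 4` an essential bound. The `n + 2` keeps these points strictly inside `(0,
  -- t)`.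
  have hleft : ∃ c ∈ Set.Ioo 0 t, ∀ᵐ τ, τ ∈ Set.Ioo c D → sInf S - ε / 2 ≤ u τ := by
    by_contra hno
    apply hnmem
    have hall : ∀ n : ℕ, ∀ᵐ τ, τ ∈ Set.Ioo 0 (t - t / (n + 2)) → u τ ≤ sInf S - ε / 4 := fun n => by
      have hpos : 0 < t / (n + 2) := by positivity
      have hlt : t / (n + 2) < t := div_lt_self ht0 (by linarith [n.cast_nonneg (α := ℝ)])
      rcases hu (t - t / (n + 2)) ⟨by linarith, by linarith⟩ (sInf S - ε / 2) (sInf S - ε / 4)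
        (by linarith) with h | h
      · exact h
      · exact absurd ⟨_, ⟨by linarith, by linarith⟩, h⟩ hno
    filter_upwards [ae_all_iff.2 hall] with τ h hτ
    obtain ⟨n, hn⟩ := exists_nat_gt (t / (t - τ))
    have hd : 0 < t - τ := by linarith [hτ.2]
    refine h n ⟨hτ.1, ?_⟩
    have : t / (n + 2) < t - τ := by
      rw [div_lt_iff₀ (by positivity)]
      rw [div_lt_iff₀ hd] at hn
      nlinarith
    linarith
  -- Otherwise the second alternative holds at points tending to `t` from the right; with `hmem`
  -- this is the excluded upward jump.
  have hright : ∃ c ∈ Set.Ioo t D, ∀ᵐ τ, τ ∈ Set.Ioo 0 c → u τ ≤ sInf S + 3 * ε / 4 := by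
    by_contra hno
    refine hjump ⟨sInf S + ε / 4, sInf S + ε / 2, by linarith, hmem, ?_⟩
    have hd0 : 0 < D - t := by linarith
    have hall : ∀ n : ℕ, ∀ᵐ τ, τ ∈ Set.Ioo (t + (D - t) / (n + 2)) D → sInf S + ε / 2 ≤ u τ :=
      fun n => by
      have hpos : 0 < (D - t) / (n + 2) := by positivity
      have hlt : (D - t) / (n + 2) < D - t :=
        div_lt_self hd0 (by linarith [n.cast_nonneg (α := ℝ)])
      rcases hu (t + (D - t) / (n + 2)) ⟨by linarith, by linarith⟩ (sInf S + ε / 2)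
        (sInf S + 3 * ε / 4) (by linarith) with h | h
      · exact absurd ⟨_, ⟨by linarith, by linarith⟩, h⟩ hno
      · exact h
    filter_upwards [ae_all_iff.2 hall] with τ h hτ
    obtain ⟨n, hn⟩ := exists_nat_gt ((D - t) / (τ - t))
    have hd : 0 < τ - t := by linarith [hτ.1]
    refine h n ⟨?_, hτ.2⟩
    have : (D - t) / (n + 2) < τ - t := by
      rw [div_lt_iff₀ (by positivity)]
      rw [div_lt_iff₀ hd] at hn
      nlinarith
    linarith
  obtain ⟨c, hc, hcl⟩ := hleft
  obtain ⟨d, hd, hdr⟩ := hright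
  have hnhds : ∀ᶠ τ in ae volume ⊓ 𝓝 t, τ ∈ Set.Ioo c d :=
    Filter.mem_inf_of_right (Ioo_mem_nhds hc.2 hd.1)
  filter_upwards [hnhds, Filter.mem_inf_of_left hcl, Filter.mem_inf_of_left hdr] with τ h1 h2 h3
  have h2' := h2 ⟨h1.1, h1.2.trans hd.2⟩
  have h3' := h3 ⟨hc.1.trans h1.1, h1.2⟩
  rw [Real.dist_eq, abs_lt]
  constructor <;> linarith

/-! ### Energy transfers, heat and throughput -/

namespace Transmitter

/-- The policy `P`, with energy removed on `A` and added on `B`, both with density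
proportional to `w`. -/
noncomputable def transfer (P w : ℝ → ℝ) (A B : Set ℝ) (α β : ℝ) (τ : ℝ) : ℝ :=
  P τ - A.indicator (fun τ => α * w τ) τ + B.indicator (fun τ => β * w τ) τ

theorem integrable_indicator_of_continuous {f : ℝ → ℝ} (hf : Continuous f) {S : Set ℝ}
    (hS : MeasurableSet S) (a b : ℝ) : IntervalIntegrable (S.indicator f) volume a b := by
  have h := hf.intervalIntegrable (μ := volume) a b
  exact ⟨h.1.indicator hS, h.2.indicator hS⟩

theorem intervalIntegrable_transfer {P w : ℝ → ℝ} {A B : Set ℝ} {α β t : ℝ}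
    (hP : IntervalIntegrable P volume 0 t) (hw : Continuous w) (hA : MeasurableSet A)
    (hB : MeasurableSet B) : IntervalIntegrable (transfer P w A B α β) volume 0 t :=
  (hP.sub (integrable_indicator_of_continuous (by fun_prop) hA 0 t)).add
    (integrable_indicator_of_continuous (by fun_prop) hB 0 t)

theorem intervalIntegral_indicator_eq {f : ℝ → ℝ} {S : Set ℝ} (hS : MeasurableSet S)
    (hS0 : S ⊆ Set.Ioi 0) {t : ℝ} (ht : 0 ≤ t) :
    ∫ τ in (0 : ℝ)..t, S.indicator f τ = ∫ τ in S ∩ Set.Iic t, f τ := by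
  rw [intervalIntegral.integral_of_le ht, setIntegral_indicator hS]
  congr 2
  ext τ
  simp only [Set.mem_inter_iff, Set.mem_Ioc, Set.mem_Iic]
  exact ⟨fun h => ⟨h.2, h.1.2⟩, fun h => ⟨⟨hS0 h.1, h.2⟩, h.1⟩⟩

theorem integral_mul_transfer {P w g : ℝ → ℝ} {A B : Set ℝ} {α β t : ℝ}
    (hP : IntervalIntegrable P volume 0 t) (hw : Continuous w) (hg : Continuous g)
    (hA : MeasurableSet A) (hB : MeasurableSet B) (hA0 : A ⊆ Set.Ioi 0) (hB0 : B ⊆ Set.Ioi 0)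
    (ht : 0 ≤ t) :
    ∫ τ in (0 : ℝ)..t, g τ * transfer P w A B α β τ =
      (∫ τ in (0 : ℝ)..t, g τ * P τ) - α * (∫ τ in A ∩ Set.Iic t, g τ * w τ) +
        β * (∫ τ in B ∩ Set.Iic t, g τ * w τ) := by
  have h1 : ∀ τ, g τ * transfer P w A B α β τ = g τ * P τ -
      A.indicator (fun τ => α * (g τ * w τ)) τ + B.indicator (fun τ => β * (g τ * w τ)) τ := by
    intro τ
    unfold transfer
    by_cases hτA : τ ∈ A <;> by_cases hτB : τ ∈ B <;> simp [hτA, hτB] <;> ring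
  simp_rw [h1]
  have iP : IntervalIntegrable (fun τ => g τ * P τ) volume 0 t := hP.continuousOn_mul hg.continuousOn
  have iA := integrable_indicator_of_continuous (f := fun τ => α * (g τ * w τ)) (by fun_prop) hA 0 t
  have iB := integrable_indicator_of_continuous (f := fun τ => β * (g τ * w τ)) (by fun_prop) hB 0 t
  rw [intervalIntegral.integral_add (iP.sub iA) iB, intervalIntegral.integral_sub iP iA,
    intervalIntegral_indicator_eq hA hA0 ht, intervalIntegral_indicator_eq hB hB0 ht,
    integral_const_mul, integral_const_mul]

/-- The integral `∫ e^{bτ} P` which determines the temperature. -/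
noncomputable def heat (m : Transmitter) (P : ℝ → ℝ) (t : ℝ) : ℝ :=
  ∫ τ in (0 : ℝ)..t, Real.exp (m.b * τ) * P τ

theorem temperature_eq (m : Transmitter) {P : ℝ → ℝ} {t : ℝ}
    (hP : IntervalIntegrable P volume 0 t) :
    m.temperature P t = m.Te + m.a * m.heat P t * Real.exp (-(m.b * t)) := by
  have hc : Continuous fun τ => Real.exp (m.b * τ) := by fun_prop
  have i1 : IntervalIntegrable (fun τ => Real.exp (m.b * τ) * P τ) volume 0 t :=
    hP.continuousOn_mul hc.continuousOn
  have i2 : IntervalIntegrable (fun τ => Real.exp (m.b * τ) * m.b) volume 0 t :=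
    Continuous.intervalIntegrable (by fun_prop) _ _
  have hint : ∫ τ in (0 : ℝ)..t, Real.exp (m.b * τ) * m.b = Real.exp (m.b * t) - 1 := by
    have hd : ∀ x ∈ Set.uIcc 0 t,
        HasDerivAt (fun τ => Real.exp (m.b * τ)) (Real.exp (m.b * x) * m.b) x := fun x _ => by
      simpa using ((hasDerivAt_id x).const_mul m.b).exp
    rw [intervalIntegral.integral_eq_sub_of_hasDerivAt hd i2]
    simp
  have hsplit : ∀ τ, Real.exp (m.b * τ) * (m.a * P τ + m.b * m.Te) =
      m.a * (Real.exp (m.b * τ) * P τ) + m.Te * (Real.exp (m.b * τ) * m.b) := fun τ => by ring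
  have he : Real.exp (-(m.b * t)) * Real.exp (m.b * t) = 1 := by rw [← Real.exp_add]; simp
  unfold temperature heat
  simp_rw [hsplit]
  rw [intervalIntegral.integral_add (i1.const_mul _) (i2.const_mul _),
    intervalIntegral.integral_const_mul, intervalIntegral.integral_const_mul, hint]
  linear_combination m.Te * he

/-- In this form the constraint is linear in `P`, with a bound independent of the policy. -/
theorem temperature_le_iff (m : Transmitter) {P : ℝ → ℝ} {t : ℝ}
    (hP : IntervalIntegrable P volume 0 t) :
    m.temperature P t ≤ m.Tc ↔ m.a * m.heat P t ≤ (m.Tc - m.Te) * Real.exp (m.b * t) := by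
  rw [m.temperature_eq hP, Real.exp_neg, ← div_eq_mul_inv, ← le_sub_iff_add_le',
    div_le_iff₀ (Real.exp_pos _)]

theorem temperature_lt_iff (m : Transmitter) {P : ℝ → ℝ} {t : ℝ}
    (hP : IntervalIntegrable P volume 0 t) :
    m.temperature P t < m.Tc ↔ m.a * m.heat P t < (m.Tc - m.Te) * Real.exp (m.b * t) := by
  rw [m.temperature_eq hP, Real.exp_neg, ← div_eq_mul_inv, ← lt_sub_iff_add_lt',
    div_lt_iff₀ (Real.exp_pos _)]

theorem intervalIntegrable_log_one_add {P : ℝ → ℝ} {D : ℝ} (hD : 0 ≤ D)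
    (hP : IntervalIntegrable P volume 0 D) (h0 : ∀ t ∈ Set.Icc 0 D, 0 ≤ P t) :
    IntervalIntegrable (fun τ => Real.log (1 + P τ)) volume 0 D := by
  rw [intervalIntegrable_iff_integrableOn_Ioc_of_le hD] at hP ⊢
  refine Integrable.mono' hP ?_ ?_
  · exact (Real.measurable_log.comp_aemeasurable
      (hP.aestronglyMeasurable.aemeasurable.const_add 1)).aestronglyMeasurable
  · filter_upwards [ae_restrict_mem measurableSet_Ioc] with τ hτ
    have := h0 τ ⟨hτ.1.le, hτ.2⟩
    rw [Real.norm_of_nonneg (Real.log_nonneg (by linarith))]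
    linarith [Real.log_le_sub_one_of_pos (show 0 < 1 + P τ by linarith)]

theorem throughput_eq (m : Transmitter) (P : ℝ → ℝ) :
    m.throughput P = 1 / (2 * Real.log 2) * ∫ τ in (0 : ℝ)..m.D, Real.log (1 + P τ) := by
  unfold throughput
  rw [← intervalIntegral.integral_const_mul]
  congr 1
  ext τ
  simp only [Real.logb]
  have : Real.log 2 ≠ 0 := (Real.log_pos one_lt_two).ne'
  field_simp

/-- Moving energy from a set of higher to a set of lower (weighted) power improves the
throughput. -/
theorem throughput_lt_transfer (m : Transmitter) {P w : ℝ → ℝ} {A B : Set ℝ} {α β x y : ℝ}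
    (hD : 0 ≤ m.D) (hP : IntervalIntegrable P volume 0 m.D) (h0 : ∀ t ∈ Set.Icc 0 m.D, 0 ≤ P t)
    (hw : Continuous w) (hw0 : ∀ τ, 0 < w τ) (hA : MeasurableSet A) (hB : MeasurableSet B)
    (hAD : A ⊆ Set.Ioc 0 m.D) (hBD : B ⊆ Set.Ioc 0 m.D) (hAB : Disjoint A B)
    (hα : 0 < α) (hβ : 0 < β) (hvol : 0 < volume.real A)
    (heq : α * volume.real A = β * volume.real B) (hx : 0 < x) (hxy : x + β < y - α)
    (hAP : ∀ τ ∈ A, y * w τ ≤ 1 + P τ) (hAw : ∀ τ ∈ A, α * w τ ≤ P τ)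
    (hBP : ∀ τ ∈ B, 1 + P τ ≤ x * w τ) :
    m.throughput P < m.throughput (transfer P w A B α β) := by
  -- `log z ≤ z - 1` for the ratio of old to new `1 + P` bounds the loss on `A` and the gain on `B`.
  -- The new value is at least `(y - α) w` on `A` and at most `(x + β) w` on `B`, so `w` cancels.
  have hpt : ∀ τ ∈ Set.Icc 0 m.D, Real.log (1 + P τ) - A.indicator (fun _ => α / (y - α)) τ +
      B.indicator (fun _ => β / (x + β)) τ ≤ Real.log (1 + transfer P w A B α β τ) := by
    intro τ hτ
    have hP0 := h0 τ hτ
    have hwτ := hw0 τ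
    unfold transfer
    by_cases hτA : τ ∈ A
    · have hτB : τ ∉ B := Set.disjoint_left.1 hAB hτA
      simp only [hτA, hτB, Set.indicator_of_mem, Set.indicator_of_notMem, not_false_eq_true,
        add_zero]
      have hX : 0 < 1 + (P τ - α * w τ) := by linarith [hAw τ hτA]
      have hlog := Real.log_le_sub_one_of_pos (div_pos (show 0 < 1 + P τ by linarith) hX)
      rw [Real.log_div (by linarith) hX.ne'] at hlog
      have hle : (1 + P τ) / (1 + (P τ - α * w τ)) - 1 ≤ α / (y - α) := by
        rw [div_sub_one hX.ne', div_le_div_iff₀ hX (by linarith)]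
        nlinarith [hAP τ hτA]
      linarith
    · by_cases hτB : τ ∈ B
      · simp only [hτA, hτB, Set.indicator_of_mem, Set.indicator_of_notMem, not_false_eq_true,
          sub_zero]
        have hX : 0 < 1 + (P τ + β * w τ) := by positivity
        have hlog := Real.log_le_sub_one_of_pos (div_pos (show 0 < 1 + P τ by linarith) hX)
        rw [Real.log_div (by linarith) hX.ne'] at hlog
        have hle : β / (x + β) ≤ 1 - (1 + P τ) / (1 + (P τ + β * w τ)) := by
          rw [one_sub_div hX.ne', div_le_div_iff₀ (by linarith) hX]
          nlinarith [hBP τ hτB]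
        linarith
      · simp [hτA, hτB]
  have hQ0 : ∀ t ∈ Set.Icc 0 m.D, 0 ≤ transfer P w A B α β t := by
    intro τ hτ
    have hB' : 0 ≤ B.indicator (fun τ => β * w τ) τ :=
      Set.indicator_nonneg (fun τ _ => (mul_pos hβ (hw0 τ)).le) τ
    unfold transfer
    by_cases hτA : τ ∈ A
    · simp only [hτA, Set.indicator_of_mem]
      linarith [hAw τ hτA]
    · simp only [hτA, Set.indicator_of_notMem, not_false_eq_true]
      linarith [h0 τ hτ]
  have iP := intervalIntegrable_log_one_add hD hP h0
  have iQ := intervalIntegrable_log_one_add hD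
    (intervalIntegrable_transfer (α := α) (β := β) hP hw hA hB) hQ0
  have iA := integrable_indicator_of_continuous (f := fun _ => α / (y - α)) (by fun_prop) hA 0 m.D
  have iB := integrable_indicator_of_continuous (f := fun _ => β / (x + β)) (by fun_prop) hB 0 m.D
  have hmono := intervalIntegral.integral_mono_on hD ((iP.sub iA).add iB) iQ hpt
  have hA' : A ∩ Set.Iic m.D = A := Set.inter_eq_left.2 fun τ h => (hAD h).2
  have hB' : B ∩ Set.Iic m.D = B := Set.inter_eq_left.2 fun τ h => (hBD h).2
  rw [intervalIntegral.integral_add (iP.sub iA) iB, intervalIntegral.integral_sub iP iA,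
    intervalIntegral_indicator_eq hA (fun τ h => (hAD h).1) hD,
    intervalIntegral_indicator_eq hB (fun τ h => (hBD h).1) hD, hA', hB', setIntegral_const,
    setIntegral_const, smul_eq_mul, smul_eq_mul] at hmono
  rw [throughput_eq, throughput_eq]
  have hlog2 : 0 < Real.log 2 := Real.log_pos one_lt_two
  refine mul_lt_mul_of_pos_left ?_ (by positivity)
  have hgain : volume.real A * (α / (y - α)) < volume.real B * (β / (x + β)) := by
    rw [← mul_div_assoc, ← mul_div_assoc, mul_comm _ α, mul_comm _ β, ← heq]
    exact div_lt_div_of_pos_left (mul_pos hα hvol) (by linarith) hxy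
  linarith

end Transmitter

/-- Since `u` is only a.e. measurable, the set is cut out by a measurable representative, and a null
set containing the disagreements is removed. The condition then holds at every point of `A`. -/
theorem exists_measurableSet_of_not_ae {u : ℝ → ℝ} {S V : Set ℝ} (hS : MeasurableSet S)
    (hV : MeasurableSet V) (hu : AEMeasurable u (volume.restrict S))
    (h : ¬ ∀ᵐ τ, τ ∈ S → u τ ∉ V) :
    ∃ A ⊆ S, MeasurableSet A ∧ volume A ≠ 0 ∧ ∀ τ ∈ A, u τ ∈ V := by
  have hg : ∀ᵐ τ, τ ∈ S → u τ = hu.mk u τ := (ae_restrict_iff' hS).1 hu.ae_eq_mk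
  obtain ⟨N, hN, hNm, hN0⟩ := exists_measurable_superset_of_null (ae_iff.1 hg)
  have hAS : ∀ τ ∈ (S ∩ hu.mk u ⁻¹' V) \ N, u τ = hu.mk u τ := fun τ hτ => by
    by_contra hne
    exact hτ.2 (hN fun h' => hne (h' hτ.1.1))
  refine ⟨(S ∩ hu.mk u ⁻¹' V) \ N, fun τ hτ => hτ.1.1,
    (hS.inter (hu.measurable_mk hV)).diff hNm, fun h0 => h ?_, fun τ hτ => ?_⟩
  · have h0' : ∀ᵐ τ, τ ∉ (S ∩ hu.mk u ⁻¹' V) \ N := measure_eq_zero_iff_ae_notMem.1 h0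
    filter_upwards [h0', measure_eq_zero_iff_ae_notMem.1 hN0, hg] with τ h1 h2 h3 hτ hV'
    rw [h3 hτ] at hV'
    exact h1 ⟨⟨hτ, hV'⟩, h2⟩
  · rw [hAS τ hτ]
    exact hτ.1.2

theorem exists_measurableSet_of_ae {p : ℝ → Prop} {S : Set ℝ} (hS : MeasurableSet S)
    (h : ∀ᵐ τ, τ ∈ S → p τ) :
    ∃ A ⊆ S, MeasurableSet A ∧ volume A = volume S ∧ ∀ τ ∈ A, p τ := by
  obtain ⟨N, hN, hNm, hN0⟩ := exists_measurable_superset_of_null (ae_iff.1 h)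
  refine ⟨S \ N, Set.sdiff_subset, hS.diff hNm, measure_sdiff_null hN0, fun τ hτ => ?_⟩
  by_contra hne
  exact hτ.2 (hN fun h' => hne (h' hτ.1))

/-! ### Set integrals truncated at a time `s` -/

section SetIntegral

variable {k : ℝ → ℝ} {S : Set ℝ} {D K : ℝ}

theorem setIntegral_inter_Iic_nonneg (hS : MeasurableSet S) (hk0 : ∀ τ, 0 ≤ k τ) (s : ℝ) :
    0 ≤ ∫ τ in S ∩ Set.Iic s, k τ :=
  setIntegral_nonneg (hS.inter measurableSet_Iic) fun τ _ => hk0 τ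

theorem setIntegral_inter_Iic_le (hk : Continuous k) (hk0 : ∀ τ, 0 ≤ k τ) (hS : MeasurableSet S)
    (hSD : S ⊆ Set.Icc 0 D) (hK : ∀ τ ∈ S, k τ ≤ K) (s : ℝ) :
    ∫ τ in S ∩ Set.Iic s, k τ ≤ K * volume.real S := by
  have hi : IntegrableOn k S := hk.integrableOn_Icc.mono_set hSD
  have hfin : volume S ≠ ⊤ :=
    ((measure_mono hSD).trans_lt (by simp)).ne
  calc ∫ τ in S ∩ Set.Iic s, k τ ≤ ∫ τ in S, k τ :=
        setIntegral_mono_set hi (Eventually.of_forall hk0) Set.inter_subset_left.eventuallyLE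
    _ ≤ ∫ _ in S, K :=
        setIntegral_mono_on hi (integrableOn_const hfin) hS hK
    _ = K * volume.real S := by rw [setIntegral_const, smul_eq_mul, mul_comm]

theorem le_setIntegral_inter_Iic (hk : Continuous k) (hS : MeasurableSet S)
    (hSD : S ⊆ Set.Icc 0 D) (hK : ∀ τ ∈ S, K ≤ k τ) {s : ℝ} (hs : S ⊆ Set.Iic s) :
    K * volume.real S ≤ ∫ τ in S ∩ Set.Iic s, k τ := by
  have hi : IntegrableOn k S := hk.integrableOn_Icc.mono_set hSD
  have hfin : volume S ≠ ⊤ :=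
    ((measure_mono hSD).trans_lt (by simp)).ne
  rw [Set.inter_eq_left.2 hs]
  calc K * volume.real S = ∫ _ in S, K := by rw [setIntegral_const, smul_eq_mul, mul_comm]
    _ ≤ ∫ τ in S, k τ := setIntegral_mono_on (integrableOn_const hfin) hi hS hK

theorem setIntegral_inter_Iic_eq_zero {s : ℝ} (hs : ∀ τ ∈ S, s < τ) :
    ∫ τ in S ∩ Set.Iic s, k τ = 0 := by
  have : S ∩ Set.Iic s = ∅ := by
    ext τ
    simp only [Set.mem_inter_iff, Set.mem_Iic, Set.mem_empty_iff_false, iff_false, not_and, not_le]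
    exact hs τ
  simp [this]

end SetIntegral

/-- Moving mass from `A` to the later set `B` decreases the integral of an antitone function. -/
theorem mul_setIntegral_le_of_antitone {k : ℝ → ℝ} {A B : Set ℝ} {c D α β : ℝ}
    (hk : Continuous k) (hk0 : ∀ τ, 0 ≤ k τ) (hanti : Antitone k) (hc : c ∈ Set.Ioo 0 D)
    (hA : MeasurableSet A) (hB : MeasurableSet B) (hAc : A ⊆ Set.Ioo 0 c) (hBc : B ⊆ Set.Ioo c D)
    (hα : 0 ≤ α) (hβ : 0 ≤ β) (heq : α * volume.real A = β * volume.real B) (s : ℝ) :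
    β * ∫ τ in B ∩ Set.Iic s, k τ ≤ α * ∫ τ in A ∩ Set.Iic s, k τ := by
  rcases le_or_gt s c with hs | hs
  · rw [setIntegral_inter_Iic_eq_zero fun τ hτ => hs.trans_lt (hBc hτ).1, mul_zero]
    exact mul_nonneg hα (setIntegral_inter_Iic_nonneg hA hk0 s)
  · have h1 := setIntegral_inter_Iic_le hk hk0 hB (D := D) (K := k c)
      (fun τ hτ => ⟨(hc.1.trans (hBc hτ).1).le, (hBc hτ).2.le⟩) (fun τ hτ => hanti (hBc hτ).1.le) s
    have h2 := le_setIntegral_inter_Iic hk hA (D := D) (K := k c) (s := s)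
      (fun τ hτ => ⟨(hAc hτ).1.le, ((hAc hτ).2.trans hc.2).le⟩) (fun τ hτ => hanti (hAc hτ).2.le)
      (fun τ hτ => ((hAc hτ).2.trans hs).le)
    calc _ ≤ β * (k c * volume.real B) := mul_le_mul_of_nonneg_left h1 hβ
      _ = k c * (β * volume.real B) := by ring
      _ = k c * (α * volume.real A) := by rw [heq]
      _ = α * (k c * volume.real A) := by ring
      _ ≤ _ := mul_le_mul_of_nonneg_left h2 hα

theorem eventually_forall_Ioo {p : ℝ → Prop} {t : ℝ} (h : ∀ᶠ s in 𝓝 t, p s) :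
    ∀ᶠ r in 𝓝[>] (0 : ℝ), ∀ s ∈ Set.Ioo (t - r) (t + r), p s := by
  obtain ⟨δ, hδ, hp⟩ := Metric.eventually_nhds_iff.1 h
  filter_upwards [Ioo_mem_nhdsGT hδ] with r hr s hs
  apply hp
  rw [Real.dist_eq, abs_lt]
  constructor <;> linarith [hs.1, hs.2, hr.2]

/-! ### Moving energy later: jumps can only go up -/

namespace Transmitter

theorem D_pos (m : Transmitter) : 0 < m.D := m.s_zero ▸ m.s_lt_D 0

theorem Feasible.integrable_to {m : Transmitter} {P : ℝ → ℝ} (hP : m.Feasible P) {t : ℝ}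
    (ht : t ∈ Set.Icc 0 m.D) : IntervalIntegrable P volume 0 t :=
  hP.integrable.mono_set (Set.uIcc_subset_uIcc_left (by rwa [Set.uIcc_of_le m.D_pos.le]))

theorem feasible_of_le {m : Transmitter} {Q : ℝ → ℝ} (hQ : IntervalIntegrable Q volume 0 m.D)
    (h0 : ∀ t ∈ Set.Icc 0 m.D, 0 ≤ Q t) (hs : ∀ t ∈ Set.Icc 0 m.D, spent Q t ≤ m.harvested t)
    (hh : ∀ t ∈ Set.Icc 0 m.D, m.a * m.heat Q t ≤ (m.Tc - m.Te) * Real.exp (m.b * t)) :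
    m.Feasible Q where
  integrable := hQ
  nonneg := h0
  temperature_le t ht := (m.temperature_le_iff (hQ.mono_set (Set.uIcc_subset_uIcc_left
    (by rwa [Set.uIcc_of_le m.D_pos.le])))).2 (hh t ht)
  causal := hs

theorem Feasible.heat_le {m : Transmitter} {P : ℝ → ℝ} (hP : m.Feasible P) {t : ℝ}
    (ht : t ∈ Set.Icc 0 m.D) :
    m.a * m.heat P t ≤ (m.Tc - m.Te) * Real.exp (m.b * t) :=
  (m.temperature_le_iff (hP.integrable_to ht)).1 (hP.temperature_le t ht)

theorem spent_transfer {P w : ℝ → ℝ} {A B : Set ℝ} {α β t : ℝ}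
    (hP : IntervalIntegrable P volume 0 t) (hw : Continuous w)
    (hA : MeasurableSet A) (hB : MeasurableSet B) (hA0 : A ⊆ Set.Ioi 0) (hB0 : B ⊆ Set.Ioi 0)
    (ht : 0 ≤ t) :
    spent (transfer P w A B α β) t =
      spent P t - α * (∫ τ in A ∩ Set.Iic t, w τ) + β * (∫ τ in B ∩ Set.Iic t, w τ) := by
  have h := integral_mul_transfer (g := fun _ => 1) (α := α) (β := β) hP hw
    continuous_const hA hB hA0 hB0 ht
  simp only [one_mul] at h
  exact h

theorem transfer_nonneg {P w : ℝ → ℝ} {A B : Set ℝ} {α β τ : ℝ} (hP : 0 ≤ P τ) (hβ : 0 ≤ β)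
    (hw : 0 ≤ w τ) (hA : τ ∈ A → α * w τ ≤ P τ) : 0 ≤ transfer P w A B α β τ := by
  have hB : 0 ≤ B.indicator (fun τ => β * w τ) τ :=
    Set.indicator_apply_nonneg fun _ => mul_nonneg hβ hw
  unfold transfer
  by_cases hτA : τ ∈ A
  · simp only [hτA, Set.indicator_of_mem]
    linarith [hA hτA]
  · simp only [hτA, Set.indicator_of_notMem, not_false_eq_true]
    linarith

/-- Along an optimal policy `(1 + P) e^{bt}` is essentially nondecreasing: otherwise energy could
be moved to a later instant in such a way that no constraint is affected. -/
theorem IsOptimal.ess_monotone {m : Transmitter} {P : ℝ → ℝ} (hP : m.IsOptimal P) {c : ℝ}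
    (hc : c ∈ Set.Ioo 0 m.D) {x y : ℝ} (hxy : x < y) :
    (∀ᵐ τ, τ ∈ Set.Ioo 0 c → (1 + P τ) * Real.exp (m.b * τ) ≤ y) ∨
      (∀ᵐ τ, τ ∈ Set.Ioo c m.D → x ≤ (1 + P τ) * Real.exp (m.b * τ)) := by
  by_contra hno
  rw [not_or] at hno
  obtain ⟨hnA, hnB⟩ := hno
  have hF := hP.1
  have hmeas : ∀ S ⊆ Set.Ioc 0 m.D,
      AEMeasurable (fun τ => (1 + P τ) * Real.exp (m.b * τ)) (volume.restrict S) := by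
    intro S hS
    have h1 := (hF.integrable.1.mono_set hS).aestronglyMeasurable.aemeasurable
    exact (h1.const_add 1).mul (by fun_prop)
  have hAD : Set.Ioo 0 c ⊆ Set.Ioc 0 m.D := fun τ h => ⟨h.1, (h.2.trans hc.2).le⟩
  have hBD : Set.Ioo c m.D ⊆ Set.Ioc 0 m.D := fun τ h => ⟨hc.1.trans h.1, h.2.le⟩
  obtain ⟨A, hAc, hA, hA0, hAu⟩ := exists_measurableSet_of_not_ae (V := Set.Ioi y)
    measurableSet_Ioo measurableSet_Ioi (hmeas _ hAD)
    (by simpa only [Set.mem_Ioi, not_lt] using hnA)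
  obtain ⟨B, hBc, hB, hB0, hBu⟩ := exists_measurableSet_of_not_ae (V := Set.Iio x)
    measurableSet_Ioo measurableSet_Iio (hmeas _ hBD)
    (by simpa only [Set.mem_Iio, not_lt] using hnB)
  have hpos : ∀ {S : Set ℝ}, S ⊆ Set.Ioc 0 m.D → volume S ≠ 0 → 0 < volume.real S := by
    intro S hS h0
    exact ENNReal.toReal_pos h0 ((measure_mono hS).trans_lt (by simp)).ne
  have hvA := hpos (hAc.trans hAD) hA0
  have hvB := hpos (hBc.trans hBD) hB0
  obtain ⟨σ, hσ⟩ : B.Nonempty := nonempty_of_measure_ne_zero hB0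
  set w : ℝ → ℝ := fun τ => Real.exp (-(m.b * τ)) with hw
  have hwc : Continuous w := by fun_prop
  have hw0 : ∀ τ, 0 < w τ := fun τ => Real.exp_pos _
  have hwe : ∀ τ, w τ * Real.exp (m.b * τ) = 1 := fun τ => by
    rw [hw, ← Real.exp_add]
    simp
  have hwanti : Antitone w := fun τ₁ τ₂ h =>
    Real.exp_le_exp.2 (neg_le_neg (mul_le_mul_of_nonneg_left h m.b_nonneg))
  have hAP : ∀ τ ∈ A, y * w τ ≤ 1 + P τ := fun τ hτ => by
    have h1 : y < (1 + P τ) * Real.exp (m.b * τ) := hAu τ hτ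
    have h2 := (mul_lt_mul_of_pos_right h1 (hw0 τ)).le
    rwa [mul_assoc, mul_comm (Real.exp _), hwe, mul_one] at h2
  have hBP : ∀ τ ∈ B, 1 + P τ ≤ x * w τ := fun τ hτ => by
    have h1 : (1 + P τ) * Real.exp (m.b * τ) < x := hBu τ hτ
    have h2 := (mul_lt_mul_of_pos_right h1 (hw0 τ)).le
    rwa [mul_assoc, mul_comm (Real.exp _), hwe, mul_one] at h2
  -- Nonnegativity of `P` at one point of `B` yields `x > 0`, and later that `A` has enough power to
  -- give away.
  have hσ1 : 1 ≤ x * w σ := by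
    have := hF.nonneg σ (Set.Ioc_subset_Icc_self (hBD (hBc hσ)))
    linarith [hBP σ hσ]
  have hx : 0 < x := pos_of_mul_pos_left (zero_lt_one.trans_le hσ1) (hw0 σ).le
  -- With `α = ε |B|` and `β = ε |A|` the masses balance, and `α + β = (y - x) / 2` is less than the
  -- gap.
  set ε : ℝ := (y - x) / (2 * (volume.real A + volume.real B)) with hε
  have hε0 : 0 < ε := div_pos (by linarith) (by positivity)
  have hεs : ε * (volume.real A + volume.real B) = (y - x) / 2 := by
    rw [hε]
    field_simp
  have hα : 0 < ε * volume.real B := mul_pos hε0 hvB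
  have hβ : 0 < ε * volume.real A := mul_pos hε0 hvA
  have heq : ε * volume.real B * volume.real A = ε * volume.real A * volume.real B := by ring
  have hgap : x + ε * volume.real A < y - ε * volume.real B := by linarith
  have hAw : ∀ τ ∈ A, ε * volume.real B * w τ ≤ P τ := fun τ hτ => by
    have h1 : x * w σ ≤ x * w τ := mul_le_mul_of_nonneg_left
      (hwanti ((hAc hτ).2.le.trans (hBc hσ).1.le)) hx.le
    have h2 : x * w τ ≤ (y - ε * volume.real B) * w τ :=
      mul_le_mul_of_nonneg_right (by linarith) (hw0 τ).le
    linarith [hAP τ hτ]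
  have hAB : Disjoint A B := Set.disjoint_left.2 fun τ h1 h2 =>
    lt_asymm (hAc h1).2 (hBc h2).1
  have hApos : A ⊆ Set.Ioi 0 := fun τ h => (hAc h).1
  have hBpos : B ⊆ Set.Ioi 0 := fun τ h => hc.1.trans (hBc h).1
  have hint := intervalIntegrable_transfer (α := ε * volume.real B) (β := ε * volume.real A)
    hF.integrable hwc hA hB
  refine (hP.2 (transfer P w A B (ε * volume.real B) (ε * volume.real A)) ?_).not_gt
    (m.throughput_lt_transfer m.D_pos.le hF.integrable hF.nonneg hwc hw0 hA hB (hAc.trans hAD)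
      (hBc.trans hBD) hAB hα hβ hvA heq hx hgap hAP hAw hBP)
  refine feasible_of_le hint (fun τ hτ => transfer_nonneg (hF.nonneg τ hτ) hβ.le (hw0 τ).le
    (hAw τ)) (fun s hs => ?_) (fun s hs => ?_)
  · rw [spent_transfer (hF.integrable_to hs) hwc hA hB hApos hBpos hs.1]
    have := mul_setIntegral_le_of_antitone hwc (fun τ => (hw0 τ).le) hwanti hc hA hB hAc hBc hα.le
      hβ.le heq s
    linarith [hF.causal s hs]
  · have hle : m.heat (transfer P w A B (ε * volume.real B) (ε * volume.real A)) s ≤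
        m.heat P s := by
      unfold heat
      rw [integral_mul_transfer (hF.integrable_to hs) hwc (by fun_prop) hA hB hApos hBpos hs.1]
      simp_rw [mul_comm (Real.exp _) (w _), hwe]
      have := mul_setIntegral_le_of_antitone (k := fun _ => 1) continuous_const
        (fun _ => zero_le_one) antitone_const hc hA hB hAc hBc hα.le hβ.le heq s
      linarith
    exact (mul_le_mul_of_nonneg_left hle m.a_nonneg).trans (hF.heat_le hs)

/-- An optimal policy can jump only upwards. -/
theorem IsOptimal.exists_lt_of_hasJumpAt {m : Transmitter} {P : ℝ → ℝ} (hP : m.IsOptimal P)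
    {t : ℝ} (ht : t ∈ Set.Ioo 0 m.D) (hjump : HasJumpAt P t) :
    ∃ p q : ℝ, p < q ∧ ∀ᶠ r in 𝓝[>] (0 : ℝ), (∀ᵐ τ, τ ∈ Set.Ioo (t - r) t → P τ ≤ p) ∧
      (∀ᵐ τ, τ ∈ Set.Ioo t (t + r) → q ≤ P τ) := by
  have hwe : ∀ τ, Real.exp (m.b * τ) * Real.exp (-(m.b * τ)) = 1 := fun τ => by
    rw [← Real.exp_add]
    simp
  have hPu : ∀ τ, P τ = (1 + P τ) * Real.exp (m.b * τ) * Real.exp (-(m.b * τ)) - 1 := fun τ => by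
    linear_combination -(1 + P τ) * hwe τ
  have hexp : ContinuousAt (fun τ => Real.exp (-(m.b * τ))) t := by fun_prop
  have hu0 : ∀ τ ∈ Set.Ioo 0 m.D, 0 ≤ (1 + P τ) * Real.exp (m.b * τ) := fun τ hτ => by
    have := hP.1.nonneg τ (Set.Ioo_subset_Icc_self hτ)
    positivity
  rcases exists_tendsto_or_jump_of_ess_monotone ht
      (u := fun τ => (1 + P τ) * Real.exp (m.b * τ)) hu0
      (fun c hc x y hxy => hP.ess_monotone hc hxy) with ⟨l, hl⟩ | ⟨x, y, hxy, hl, hr⟩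
  · refine absurd ⟨l * Real.exp (-(m.b * t)) - 1, ?_⟩ hjump
    rw [funext hPu]
    exact (hl.mul (hexp.tendsto.mono_left inf_le_right)).sub_const 1
  · set e := Real.exp (-(m.b * t)) with he
    have he0 : 0 < e := Real.exp_pos _
    have hlt : x * e < y * e := mul_lt_mul_of_pos_right hxy he0
    have h1 : ∀ᶠ τ in 𝓝 t, x * Real.exp (-(m.b * τ)) < (2 * x * e + y * e) / 3 :=
      (hexp.tendsto.const_mul x).eventually_lt_const (by linarith)
    have h2 : ∀ᶠ τ in 𝓝 t, (x * e + 2 * y * e) / 3 < y * Real.exp (-(m.b * τ)) :=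
      (hexp.tendsto.const_mul y).eventually_const_lt (by linarith)
    -- Thirds of the gap between `x e` and `y e` leave room for the variation of `e^{-bτ}` near `t`.
    refine ⟨(2 * x * e + y * e) / 3 - 1, (x * e + 2 * y * e) / 3 - 1, by linarith, ?_⟩
    filter_upwards [eventually_forall_Ioo (h1.and h2),
      eventually_forall_Ioo (Ioo_mem_nhds ht.1 ht.2), self_mem_nhdsWithin] with r hr1 hr2 hr0
    have hr0' : 0 < r := hr0
    constructor
    · filter_upwards [hl] with τ h hτ
      have hτ' : τ ∈ Set.Ioo (t - r) (t + r) := ⟨hτ.1, by linarith [hτ.2]⟩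
      have := mul_le_mul_of_nonneg_right (h ⟨(hr2 τ hτ').1, hτ.2⟩) (Real.exp_pos (-(m.b * τ))).le
      linarith [hPu τ, (hr1 τ hτ').1]
    · filter_upwards [hr] with τ h hτ
      have hτ' : τ ∈ Set.Ioo (t - r) (t + r) := ⟨by linarith [hτ.1], hτ.2⟩
      have := mul_le_mul_of_nonneg_right (h ⟨hτ.1, (hr2 τ hτ').2⟩) (Real.exp_pos (-(m.b * τ))).le
      linarith [hPu τ, (hr1 τ hτ').2]

end Transmitter

/-! ### Local constraints at an upward jump -/

theorem continuousAt_primitive {f : ℝ → ℝ} {D t : ℝ} (hf : IntervalIntegrable f volume 0 D)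
    (ht : t ∈ Set.Ioo 0 D) : ContinuousAt (fun s => ∫ τ in (0 : ℝ)..s, f τ) t := by
  have h := intervalIntegral.continuousOn_primitive_interval' hf Set.left_mem_uIcc
  rw [Set.uIcc_of_le (ht.1.trans ht.2).le] at h
  exact h.continuousAt (Icc_mem_nhds ht.1 ht.2)

theorem primitive_add_integral {f : ℝ → ℝ} {D c d : ℝ} (hf : IntervalIntegrable f volume 0 D)
    (hc : c ∈ Set.Icc 0 D) (hd : d ∈ Set.Icc 0 D) :
    IntervalIntegrable f volume c d ∧
      ∫ τ in (0 : ℝ)..d, f τ = (∫ τ in (0 : ℝ)..c, f τ) + ∫ τ in c..d, f τ := by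
  have hD : 0 ≤ D := hc.1.trans hc.2
  have h : ∀ e ∈ Set.Icc 0 D, IntervalIntegrable f volume 0 e := fun e he =>
    hf.mono_set (Set.uIcc_subset_uIcc_left (by rwa [Set.uIcc_of_le hD]))
  have hcd := (h c hc).symm.trans (h d hd)
  exact ⟨hcd, (intervalIntegral.integral_add_adjacent_intervals (h c hc) hcd).symm⟩

theorem integral_mono_of_ae_Ioo {f g : ℝ → ℝ} {c d : ℝ} (hcd : c ≤ d)
    (hf : IntervalIntegrable f volume c d) (hg : IntervalIntegrable g volume c d)
    (h : ∀ᵐ τ, τ ∈ Set.Ioo c d → f τ ≤ g τ) : ∫ τ in c..d, f τ ≤ ∫ τ in c..d, g τ := by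
  refine intervalIntegral.integral_mono_ae_restrict hcd hf hg ?_
  rw [← Measure.restrict_congr_set Ioo_ae_eq_Icc]
  exact (ae_restrict_iff' measurableSet_Ioo).2 h

namespace Transmitter

/-- Arrivals strictly before `t` are also strictly before every nearby `s`, even for `s < t`. -/
theorem eventually_harvested_le (m : Transmitter) (t : ℝ) :
    ∀ᶠ s in 𝓝 t, m.harvested t ≤ m.harvested s := by
  have h : ∀ᶠ s in 𝓝 t, ∀ i, m.s i < t → m.s i < s :=
    eventually_all.2 fun i => by
      by_cases hi : m.s i < t
      · filter_upwards [lt_mem_nhds hi] with s hs _ using hs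
      · exact Eventually.of_forall fun s h' => absurd h' hi
  filter_upwards [h] with s hs
  refine Finset.sum_le_sum_of_subset_of_nonneg (fun i hi => ?_) fun i _ _ => m.E_nonneg i
  simp only [Finset.mem_filter, Finset.mem_univ, true_and] at hi ⊢
  exact hs i hi

theorem eventually_harvested_eq (m : Transmitter) {t : ℝ} (ht : ∀ i, t ≠ m.s i) :
    ∀ᶠ s in 𝓝 t, m.harvested s = m.harvested t := by
  have h : ∀ᶠ s in 𝓝 t, ∀ i, m.s i < s ↔ m.s i < t :=
    eventually_all.2 fun i => by
      rcases lt_or_gt_of_ne (ht i) with hi | hi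
      · filter_upwards [gt_mem_nhds hi] with s hs
        exact ⟨fun h => absurd h hs.not_gt, fun h => absurd h hi.not_gt⟩
      · filter_upwards [lt_mem_nhds hi] with s hs
        exact ⟨fun _ => hi, fun _ => hs⟩
  filter_upwards [h] with s hs
  unfold harvested
  simp_rw [hs]

theorem integrable_exp_mul (m : Transmitter) {P : ℝ → ℝ} {D : ℝ}
    (hP : IntervalIntegrable P volume 0 D) :
    IntervalIntegrable (fun τ => Real.exp (m.b * τ) * P τ) volume 0 D :=
  hP.continuousOn_mul (by fun_prop)

theorem b_mul_integral_exp (m : Transmitter) (c d : ℝ) :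
    m.b * ∫ τ in c..d, Real.exp (m.b * τ) = Real.exp (m.b * d) - Real.exp (m.b * c) := by
  rw [← intervalIntegral.integral_const_mul]
  refine intervalIntegral.integral_eq_sub_of_hasDerivAt (f := fun τ => Real.exp (m.b * τ))
    (fun x _ => ?_) (Continuous.intervalIntegrable (by fun_prop) _ _)
  simpa [mul_comm] using ((hasDerivAt_id x).const_mul m.b).exp

/-- There is no upward jump while the temperature is critical. -/
theorem Feasible.temperature_lt_of_jump {m : Transmitter} {P : ℝ → ℝ} (hP : m.Feasible P)
    {t p q : ℝ} (ht : t ∈ Set.Ioo 0 m.D) (hpq : p < q)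
    (h : ∀ᶠ r in 𝓝[>] (0 : ℝ), (∀ᵐ τ, τ ∈ Set.Ioo (t - r) t → P τ ≤ p) ∧
      (∀ᵐ τ, τ ∈ Set.Ioo t (t + r) → q ≤ P τ)) : m.temperature P t < m.Tc := by
  have htI := Set.Ioo_subset_Icc_self ht
  rw [m.temperature_lt_iff (hP.integrable_to htI)]
  by_contra hcon
  have heq : m.a * m.heat P t = (m.Tc - m.Te) * Real.exp (m.b * t) :=
    le_antisymm (hP.heat_le htI) (not_lt.1 hcon)
  have hT : 0 < m.Tc - m.Te := sub_pos.2 m.Te_lt_Tc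
  have ha : 0 < m.a := by
    refine m.a_nonneg.lt_of_ne fun h0 => ?_
    rw [← h0, zero_mul] at heq
    exact (mul_pos hT (Real.exp_pos _)).ne heq
  have hlen : ∀ᶠ r in 𝓝[>] (0 : ℝ), r < min t (m.D - t) :=
    eventually_nhdsWithin_of_eventually_nhds
      (gt_mem_nhds (lt_min ht.1 (sub_pos.2 ht.2)))
  obtain ⟨r, ⟨⟨hl, hr⟩, hrt⟩, hr0⟩ := ((h.and hlen).and self_mem_nhdsWithin).exists
  have hr0' : 0 < r := hr0
  have hrt1 := hrt.trans_le (min_le_left _ _)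
  have hrt2 := hrt.trans_le (min_le_right _ _)
  have hlI : t - r ∈ Set.Icc 0 m.D := ⟨by linarith, by linarith [ht.2]⟩
  have hrI : t + r ∈ Set.Icc 0 m.D := ⟨by linarith [ht.1], by linarith⟩
  have hi := m.integrable_exp_mul hP.integrable
  obtain ⟨il, el⟩ := primitive_add_integral hi hlI htI
  obtain ⟨ir, er⟩ := primitive_add_integral hi htI hrI
  have hic : ∀ z c d : ℝ, IntervalIntegrable (fun τ => Real.exp (m.b * τ) * z) volume c d :=
    fun z c d => Continuous.intervalIntegrable (by fun_prop) _ _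
  have Jpos : ∀ c d : ℝ, c < d → 0 < ∫ τ in c..d, Real.exp (m.b * τ) := fun c d hcd =>
    intervalIntegral.intervalIntegral_pos_of_pos
      (Continuous.intervalIntegrable (by fun_prop) _ _) (fun τ => Real.exp_pos _) hcd
  have ml : ∫ τ in (t - r)..t, Real.exp (m.b * τ) * P τ ≤
      (∫ τ in (t - r)..t, Real.exp (m.b * τ)) * p := by
    rw [← intervalIntegral.integral_mul_const]
    refine integral_mono_of_ae_Ioo (by linarith) il (hic _ _ _) ?_
    filter_upwards [hl] with τ h' hτ
      using mul_le_mul_of_nonneg_left (h' hτ) (Real.exp_pos _).le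
  have mr : (∫ τ in t..(t + r), Real.exp (m.b * τ)) * q ≤
      ∫ τ in t..(t + r), Real.exp (m.b * τ) * P τ := by
    rw [← intervalIntegral.integral_mul_const]
    refine integral_mono_of_ae_Ioo (by linarith) (hic _ _ _) ir ?_
    filter_upwards [hr] with τ h' hτ
      using mul_le_mul_of_nonneg_left (h' hτ) (Real.exp_pos _).le
  have bl := m.b_mul_integral_exp (t - r) t
  have br := m.b_mul_integral_exp t (t + r)
  have Jl := Jpos (t - r) t (by linarith)
  have Jr := Jpos t (t + r) (by linarith)
  have hhl := hP.heat_le hlI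
  have hhr := hP.heat_le hrI
  unfold heat at heq hhl hhr
  rw [er, mul_add, heq] at hhr
  rw [el, mul_add] at heq
  have h1 := mul_le_mul_of_nonneg_left ml ha.le
  have h2 := mul_le_mul_of_nonneg_left mr ha.le
  set Il := ∫ τ in (t - r)..t, Real.exp (m.b * τ)
  set Ir := ∫ τ in t..(t + r), Real.exp (m.b * τ)
  -- Equality at `t` and the bound at `t - r` force heat to rise on the left at least as fast as its
  -- bound; `h2'` is the reverse on the right.
  have h1' : Il * ((m.Tc - m.Te) * m.b) ≤ Il * (m.a * p) := by
    have : Il * ((m.Tc - m.Te) * m.b) = (m.Tc - m.Te) * Real.exp (m.b * t) -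
        (m.Tc - m.Te) * Real.exp (m.b * (t - r)) := by rw [← mul_sub, ← bl]; ring
    linarith
  have h2' : Ir * (m.a * q) ≤ Ir * ((m.Tc - m.Te) * m.b) := by
    have : Ir * ((m.Tc - m.Te) * m.b) = (m.Tc - m.Te) * Real.exp (m.b * (t + r)) -
        (m.Tc - m.Te) * Real.exp (m.b * t) := by rw [← mul_sub, ← br]; ring
    linarith
  linarith [le_of_mul_le_mul_left h1' Jl, le_of_mul_le_mul_left h2' Jr,
    mul_lt_mul_of_pos_left hpq ha]

/-- If the battery is empty at an instant which is not an arrival, then no energy can be used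
immediately afterwards. -/
theorem Feasible.exists_eq_arrival {m : Transmitter} {P : ℝ → ℝ} (hP : m.Feasible P) {t q : ℝ}
    (ht : t ∈ Set.Ioo 0 m.D) (hq : 0 < q)
    (h : ∀ᶠ r in 𝓝[>] (0 : ℝ), ∀ᵐ τ, τ ∈ Set.Ioo t (t + r) → q ≤ P τ)
    (he : m.BatteryEmpty P t) : ∃ i, t = m.s i := by
  by_contra! hno
  have htI := Set.Ioo_subset_Icc_self ht
  have hlen : ∀ᶠ r in 𝓝[>] (0 : ℝ), r < m.D - t :=
    eventually_nhdsWithin_of_eventually_nhds (gt_mem_nhds (sub_pos.2 ht.2))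
  have hmap : Tendsto (fun r => t + r) (𝓝[>] (0 : ℝ)) (𝓝 t) := by
    have : Tendsto (fun r => t + r) (𝓝 (0 : ℝ)) (𝓝 (t + 0)) :=
      (continuous_const.add continuous_id).tendsto 0
    rw [add_zero] at this
    exact this.mono_left nhdsWithin_le_nhds
  obtain ⟨r, ⟨⟨hr, hrt⟩, hH⟩, hr0⟩ := (((h.and hlen).and
    (hmap.eventually (m.eventually_harvested_eq hno))).and self_mem_nhdsWithin).exists
  have hr0' : 0 < r := hr0
  have hrI : t + r ∈ Set.Icc 0 m.D := ⟨by linarith [ht.1], by linarith⟩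
  obtain ⟨ir, er⟩ := primitive_add_integral hP.integrable htI hrI
  have mr : ∫ _ in t..(t + r), q ≤ ∫ τ in t..(t + r), P τ :=
    integral_mono_of_ae_Ioo (by linarith) intervalIntegrable_const ir hr
  rw [intervalIntegral.integral_const, smul_eq_mul] at mr
  have hc := hP.causal _ hrI
  unfold BatteryEmpty at he
  unfold spent at he hc
  rw [er, hH, he] at hc
  nlinarith [mul_pos hr0' hq]

/-- Mass moved from `A ⊆ (t, t + r)` to `B ⊆ (t - r, t)` changes the integral of a monotone function
only locally, by a bounded amount, and does not increase it otherwise. -/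
theorem setIntegral_sub_le_of_monotone {g : ℝ → ℝ} {A B : Set ℝ} {t r D : ℝ} (hg : Continuous g)
    (hg0 : ∀ τ, 0 ≤ g τ) (hmono : Monotone g) (hA : MeasurableSet A) (hB : MeasurableSet B)
    (hr : 0 < r) (htr : r < t) (hDr : t + r < D)
    (hAt : A ⊆ Set.Ioo t (t + r)) (hBt : B ⊆ Set.Ioo (t - r) t)
    (hvA : volume.real A = r) (hvB : volume.real B = r) (s : ℝ) :
    (∫ τ in B ∩ Set.Iic s, g τ) - (∫ τ in A ∩ Set.Iic s, g τ) ≤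
      if s ∈ Set.Ioo (t - r) (t + r) then g t * r else 0 := by
  have hBD : B ⊆ Set.Icc 0 D := fun τ h => ⟨by linarith [(hBt h).1], by linarith [(hBt h).2]⟩
  have hAD : A ⊆ Set.Icc 0 D := fun τ h => ⟨by linarith [(hAt h).1], by linarith [(hAt h).2]⟩
  have h1 := setIntegral_inter_Iic_le hg hg0 hB hBD (fun τ h => hmono (hBt h).2.le) s
  rw [hvB] at h1
  split_ifs with hs
  · linarith [setIntegral_inter_Iic_nonneg hA hg0 s]
  · rcases le_or_gt s (t - r) with hs' | hs'
    · rw [setIntegral_inter_Iic_eq_zero fun τ hτ => hs'.trans_lt (hBt hτ).1]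
      linarith [setIntegral_inter_Iic_nonneg hA hg0 s]
    · have hs2 : t + r ≤ s := not_lt.1 fun h => hs ⟨hs', h⟩
      have h2 := le_setIntegral_inter_Iic hg hA hAD (fun τ h => hmono (hAt h).1.le)
        (s := s) (fun τ h => (hAt h).2.le.trans hs2)
      rw [hvA] at h2
      linarith

/-- Where an optimal policy jumps upwards below the critical temperature, the battery is empty:
otherwise energy could be used earlier. -/
theorem IsOptimal.batteryEmpty_of_jump {m : Transmitter} {P : ℝ → ℝ} (hP : m.IsOptimal P)
    {t p q : ℝ} (ht : t ∈ Set.Ioo 0 m.D) (hp : 0 ≤ p) (hpq : p < q)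
    (h : ∀ᶠ r in 𝓝[>] (0 : ℝ), (∀ᵐ τ, τ ∈ Set.Ioo (t - r) t → P τ ≤ p) ∧
      (∀ᵐ τ, τ ∈ Set.Ioo t (t + r) → q ≤ P τ)) (hT : m.temperature P t < m.Tc) :
    m.BatteryEmpty P t := by
  have hF := hP.1
  have htI := Set.Ioo_subset_Icc_self ht
  by_contra hne
  have hE : spent P t < m.harvested t := (hF.causal t htI).lt_of_ne hne
  rw [m.temperature_lt_iff (hF.integrable_to htI)] at hT
  -- These intermediate levels make the slack in both constraints uniform near `t`.
  obtain ⟨σ₁, hσ₁, hσ₁'⟩ := exists_between hE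
  obtain ⟨σ₂, hσ₂, hσ₂'⟩ := exists_between hT
  obtain ⟨σ₃, hσ₃, hσ₃'⟩ := exists_between hσ₂'
  have e1 : ∀ᶠ s in 𝓝 t, spent P s < σ₁ :=
    (continuousAt_primitive hF.integrable ht).tendsto.eventually_lt_const hσ₁
  have e2 : ∀ᶠ s in 𝓝 t, m.a * m.heat P s < σ₂ :=
    ((continuousAt_primitive (m.integrable_exp_mul hF.integrable) ht).tendsto.const_mul
      m.a).eventually_lt_const hσ₂
  have e3 : ∀ᶠ s in 𝓝 t, σ₃ < (m.Tc - m.Te) * Real.exp (m.b * s) := by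
    have hc : Continuous fun s => (m.Tc - m.Te) * Real.exp (m.b * s) := by fun_prop
    exact hc.continuousAt.tendsto.eventually_const_lt hσ₃'
  have hlen : ∀ᶠ r in 𝓝[>] (0 : ℝ), r < min t (m.D - t) :=
    eventually_nhdsWithin_of_eventually_nhds
      (gt_mem_nhds (lt_min ht.1 (sub_pos.2 ht.2)))
  obtain ⟨r, ⟨⟨⟨hl, hr⟩, hrt⟩, hloc⟩, hr0⟩ := (((h.and hlen).and (eventually_forall_Ioo
    ((e1.and (m.eventually_harvested_le t)).and (e2.and e3)))).and self_mem_nhdsWithin).exists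
  have hr0 : 0 < r := hr0
  have hrt1 := hrt.trans_le (min_le_left _ _)
  have hrt2 := hrt.trans_le (min_le_right _ _)
  obtain ⟨A, hAt, hA, hvA, hAP⟩ := exists_measurableSet_of_ae measurableSet_Ioo hr
  obtain ⟨B, hBt, hB, hvB, hBP⟩ := exists_measurableSet_of_ae measurableSet_Ioo hl
  have hvA' : volume.real A = r := by
    rw [measureReal_def, hvA, Real.volume_Ioo, ENNReal.toReal_ofReal (by linarith)]
    ring
  have hvB' : volume.real B = r := by
    rw [measureReal_def, hvB, Real.volume_Ioo, ENNReal.toReal_ofReal (by linarith)]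
    ring
  set G := Real.exp (m.b * t) with hG
  have hG0 : 0 < G := Real.exp_pos _
  -- The three bounds serve the throughput gain, energy causality and temperature. As `p ≥ 0`, the
  -- first also gives `ε ≤ q`, so the power stays nonnegative on `A`.
  obtain ⟨ε, ⟨⟨hε1, hε2⟩, hε3⟩, hε0⟩ : ∃ ε : ℝ, ((ε < (q - p) / 2 ∧ ε * r < m.harvested t - σ₁) ∧
      m.a * (ε * (G * r)) < σ₃ - σ₂) ∧ 0 < ε := by
    have c1 : ∀ᶠ ε in 𝓝[>] (0 : ℝ), ε < (q - p) / 2 :=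
      eventually_nhdsWithin_of_eventually_nhds (gt_mem_nhds (by linarith))
    have c2 : ∀ᶠ ε in 𝓝[>] (0 : ℝ), ε * r < m.harvested t - σ₁ :=
      eventually_nhdsWithin_of_eventually_nhds <|
        (show Continuous fun ε : ℝ => ε * r by fun_prop).continuousAt.tendsto.eventually_lt_const
          (by linarith)
    have c3 : ∀ᶠ ε in 𝓝[>] (0 : ℝ), m.a * (ε * (G * r)) < σ₃ - σ₂ :=
      eventually_nhdsWithin_of_eventually_nhds <|
        (show Continuous fun ε : ℝ => m.a * (ε * (G * r)) by
          fun_prop).continuousAt.tendsto.eventually_lt_const (by linarith)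
    exact (((c1.and c2).and c3).and self_mem_nhdsWithin).exists
  have hAD : A ⊆ Set.Ioc 0 m.D := fun τ hτ =>
    ⟨by linarith [(hAt hτ).1, ht.1], by linarith [(hAt hτ).2]⟩
  have hBD : B ⊆ Set.Ioc 0 m.D := fun τ hτ =>
    ⟨by linarith [(hBt hτ).1], by linarith [(hBt hτ).2, ht.2]⟩
  have hApos : A ⊆ Set.Ioi 0 := fun τ hτ => (hAD hτ).1
  have hBpos : B ⊆ Set.Ioi 0 := fun τ hτ => (hBD hτ).1
  have hAB : Disjoint A B := Set.disjoint_left.2 fun τ h1 h2 => lt_asymm (hAt h1).1 (hBt h2).2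
  have hwc : Continuous fun _ : ℝ => (1 : ℝ) := continuous_const
  have hAw : ∀ τ ∈ A, ε * 1 ≤ P τ := fun τ hτ => by linarith [hAP τ hτ]
  -- With unit weight the energy spent is unchanged from `t + r` on, while the heat cannot be larger
  -- there because `e^{bτ}` is monotone.
  refine (hP.2 (transfer P (fun _ => 1) A B ε ε) ?_).not_gt
    (m.throughput_lt_transfer (x := 1 + p) (y := 1 + q) m.D_pos.le hF.integrable hF.nonneg hwc
      (fun _ => one_pos) hA hB hAD hBD hAB hε0 hε0 (hvA'.symm ▸ hr0) (by rw [hvA', hvB'])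
      (by linarith) (by linarith) (fun τ hτ => by linarith [hAP τ hτ]) hAw
      (fun τ hτ => by linarith [hBP τ hτ]))
  refine feasible_of_le (intervalIntegrable_transfer hF.integrable hwc hA hB)
    (fun τ hτ => transfer_nonneg (hF.nonneg τ hτ) hε0.le zero_le_one (hAw τ))
    (fun s hs => ?_) (fun s hs => ?_)
  · rw [spent_transfer (hF.integrable_to hs) hwc hA hB hApos hBpos hs.1]
    have hle := mul_le_mul_of_nonneg_left (setIntegral_sub_le_of_monotone (D := m.D) hwc
      (fun _ => zero_le_one) monotone_const hA hB hr0 hrt1 (by linarith) hAt hBt hvA' hvB' s) hε0.le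
    split_ifs at hle with hs'
    · obtain ⟨⟨h1, h2⟩, _⟩ := hloc s hs'
      linarith
    · linarith [hF.causal s hs]
  · have hgc : Continuous fun τ => Real.exp (m.b * τ) := by fun_prop
    have hle := mul_le_mul_of_nonneg_left (setIntegral_sub_le_of_monotone (D := m.D) hgc
      (fun _ => (Real.exp_pos _).le)
      (fun τ₁ τ₂ h => Real.exp_le_exp.2 (mul_le_mul_of_nonneg_left h m.b_nonneg))
      hA hB hr0 hrt1 (by linarith) hAt hBt hvA' hvB' s) hε0.le
    have heat_eq : m.heat (transfer P (fun _ => 1) A B ε ε) s = m.heat P s +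
        ε * ((∫ τ in B ∩ Set.Iic s, Real.exp (m.b * τ)) -
          ∫ τ in A ∩ Set.Iic s, Real.exp (m.b * τ)) := by
      unfold heat
      rw [integral_mul_transfer (hF.integrable_to hs) hwc hgc hA hB hApos hBpos hs.1]
      simp only [mul_one]
      ring
    have hle' := mul_le_mul_of_nonneg_left hle m.a_nonneg
    rw [heat_eq, mul_add]
    split_ifs at hle' with hs'
    · obtain ⟨_, h1, h2⟩ := hloc s hs'
      linarith
    · linarith [hF.heat_le hs]

end Transmitter

/-! ### Conclusion -/

theorem lemma11 (m : Transmitter) (P : ℝ → ℝ) (hP : m.IsOptimal P)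
    (t : ℝ) (ht : t ∈ Set.Ioo 0 m.D) (hjump : HasJumpAt P t) :
    (∃ k : Fin (m.N + 1), k ≠ 0 ∧ t = m.s k) ∧
      m.BatteryEmpty P t ∧ m.temperature P t < m.Tc := by
  obtain ⟨p, q, hpq, h⟩ := hP.exists_lt_of_hasJumpAt ht hjump
  have hT := hP.1.temperature_lt_of_jump ht hpq h
  -- As an essential upper bound of a nonnegative function, `p` is nonnegative; this is what makes
  -- `q` positive.
  have hp : 0 ≤ p := by
    have hlen : ∀ᶠ r in 𝓝[>] (0 : ℝ), r < t :=
      eventually_nhdsWithin_of_eventually_nhds (gt_mem_nhds ht.1)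
    obtain ⟨r, ⟨⟨hl, _⟩, hrt⟩, hr0⟩ := ((h.and hlen).and self_mem_nhdsWithin).exists
    have hr0 : 0 < r := hr0
    obtain ⟨τ, hτ, hle⟩ := exists_mem_Ioo_of_ae (show t - r < t by linarith) hl
    exact (hP.1.nonneg τ ⟨by linarith [hτ.1], by linarith [hτ.2, ht.2]⟩).trans hle
  have hE := hP.batteryEmpty_of_jump ht hp hpq h hT
  obtain ⟨k, hk⟩ := hP.1.exists_eq_arrival ht (hp.trans_lt hpq) (h.mono fun _ hr => hr.2) hE
  refine ⟨⟨k, fun h0 => ?_, hk⟩, hE, hT⟩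
  rw [h0, m.s_zero] at hk
  exact ht.1.ne' hk
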